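/- Let $\Sigma$ be a finite set, let $R$ be a reflexive and symmetric relation on $\Sigma$, and let $\mathcal M_\Sigma=\langle \Sigma \mid ab=ba \text{ for } (a,b)\notin R\rangle$ be the trace monoid; $|x|$ is the length of $x\in\mathcal M_\Sigma$, and for $S\subseteq\Sigma$, $\mathcal M_S$ is the submonoid generated by $S$. For $x\in\mathcal M_\Sigma$, $\max(x)\subseteq\Sigma$ is the set of labels of the maximal elements of the heap of $x$: for any word $w_1\cdots w_n$ representing $x$, this heap is $\{1,\dots,n\}$, with $i$ labelled by $w_i$, ordered by the reflexive transitive closure of the relations $i\le j$ with $(w_i,w_j)\in R$. For $S\subseteq\Sigma$ let $\mu_S(X)=\sum_{\gamma}(-1)^{|\gamma|}X^{|\gamma|}$, where $\gamma$ ranges over the subsets of $S$ whose distinct elements are pairwise not $R$-related, and let $p_\Sigma\in(0,\infty]$ be the smallest modulus of a complex root of $\mu_\Sigma$ ($p_\Sigma=\infty$ if $\Sigma=\emptyset$). Put $\mathrm{Lk}(a)=\{b\in\Sigma : (a,b)\in R\}$. Let $p\in(0,p_\Sigma)$. For $S\subseteq\Sigma$ let $B_{S,p}$ be the measure on $\mathcal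 M_S$ with $B_{S,p}(\{x\})=\mu_S(p)\,p^{|x|}$. Consider the following recursive random algorithm, whose input is a pair $(S,T)$ of subsets of $\Sigma$ and in which all the values $\mu_X(p)$, $X\subseteq\Sigma$, are precomputed. 1. If $S\cap T=\emptyset$, return $1$. 2. Otherwise choose (arbitrarily) $a\in S\cap T$, set $r=1-\mu_S(p)/\mu_{S\setminus\{a\}}(p)$, draw an integer $K\ge 0$ with the geometric law $\mathbb P(K=k)=(1-r)r^k$, and set $\xi=1$. 3. For $i=0,\dots,K-1$: let $v$ be the output of the algorithm on input $(S\setminus\{a\},\mathrm{Lk}(a))$, and replace $\xi$ by $\xi\cdot v\cdot a$. 4. Let $u$ be the output of the algorithm on input $(S\setminus\{a\},T)$; return $\xi\cdot u$. Then, for all $S\subseteq\Sigma$, $\mu_S(p)>0$ and $B_{S,p}$ is a probability distribution, and the algorithm is well defined, with $r\in(0,1)$ at every call. Whatever choices of $a$ are made (they may depend on the values of the program's variables): - on input $(\Sigma,\Sigma)$ the output $\xi\in\mathcal M_\Sigma$ is distributed according to $B_{\Sigma,p}$; - more generally, on input $(S,T)$ the output $\xi\in\mathcal M_S$ is distributed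 according to $B_{S,p}$ conditioned on $\{\max(\xi)\subseteq T\}$. Assume moreover that every elementary operation (function call, test, choice of an element, evaluation of $r$, variable assignment, multiplication in $\mathcal M_\Sigma$, loop control, return) takes a constant number of steps, and that the routine that draws a random integer takes, besides the cost of its call, at most $k$ steps when it outputs $k$. Then there is a constant $C$, depending only on these constants, such that every execution on input $(\Sigma,\Sigma)$, with $\Sigma\neq\emptyset$, that outputs $\xi$ takes at most $C\,|\Sigma|\,(|\xi|+1)$ steps, and every execution on input $(S,T)$ that outputs $\xi$ takes at most $C\,(|S|+1)(|\xi|+1)$ steps. -/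

import Mathlib

universe u

noncomputable section

namespace TraceSampling

open MeasureTheory Polynomial
open scoped ENNReal

section Traces

variable {σ : Type u}

/-- The defining relations `ab = ba` for `(a, b) ∉ R`. -/
inductive CommRel (R : σ → σ → Prop) : FreeMonoid σ → FreeMonoid σ → Prop
  | swap (a b : σ) (h : ¬ R a b) :
      CommRel R (FreeMonoid.of a * FreeMonoid.of b) (FreeMonoid.of b * FreeMonoid.of a)

/-- The trace monoid `⟨σ | ab = ba for (a, b) ∉ R⟩`. -/
abbrev TraceMonoid (R : σ → σ → Prop) : Type u := PresentedMonoid (CommRel R)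

/-- The trace monoid is a discrete (countable) space. -/
instance (R : σ → σ → Prop) : MeasurableSpace (TraceMonoid R) := ⊤

variable (R : σ → σ → Prop)

/-- The generator of the trace monoid given by a letter. -/
def letter (a : σ) : TraceMonoid R := PresentedMonoid.of (CommRel R) a

/-- The trace (equivalence class) of a word. -/
def ofWord (w : List σ) : TraceMonoid R := (w.map (letter R)).prod

/-- The length of a trace, as a monoid homomorphism. -/
def lengthHom : TraceMonoid R →* Multiplicative ℕ :=
  PresentedMonoid.lift (fun _ : σ => Multiplicative.ofAdd 1) (by
    rintro _ _ ⟨a, b, h⟩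
    rfl)

variable {R} in
/-- The length `|x|` of a trace `x`: the common length of the words in its class. -/
def length (x : TraceMonoid R) : ℕ := (lengthHom R x).toAdd

/-- `M_S`: the submonoid generated by the letters in `S`. -/
def subTraces (S : Finset σ) : Submonoid (TraceMonoid R) :=
  Submonoid.closure (letter R '' (S : Set σ))

/-- The order of the heap of a word `w`. The elements of the heap are the positions of `w`, position
`i` being labelled by `w.get i`, and the order is the transitive closure of the relations `i ≤ j`
between positions with `R`-related labels. Words of the same trace have isomorphic heaps. -/
def heapLE (w : List σ) : Fin w.length → Fin w.length → Prop :=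
  Relation.ReflTransGen fun i j => i ≤ j ∧ R (w.get i) (w.get j)

variable {R} in
/-- `max(x)`: the labels of the maximal elements of the heap of the trace `x`. -/
def maxLabels (x : TraceMonoid R) : Set σ :=
  {a | ∃ w : List σ, ofWord R w = x ∧
    ∃ i : Fin w.length, w.get i = a ∧ ∀ j, heapLE R w i j → j = i}

end Traces

section Mobius

variable {σ : Type u} [DecidableEq σ] (R : σ → σ → Prop) [DecidableRel R]

/-- The Möbius polynomial `μ_S`. A clique `a₁ ⋯ a_k` (a product of distinct, pairwise not
`R`-related letters of `S`) is encoded by its set of letters. -/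
def mobius (S : Finset σ) : ℝ[X] :=
  ∑ γ ∈ S.powerset with ∀ a ∈ γ, ∀ b ∈ γ, a ≠ b → ¬ R a b, (-1) ^ γ.card * X ^ γ.card

/-- `p_S`: the smallest modulus of a complex root of `μ_S`; it is `∞` for the empty alphabet, where
`μ_S = 1` has no root. -/
def smallestRoot (S : Finset σ) : ℝ≥0∞ :=
  ⨅ z ∈ {z : ℂ | aeval z (mobius R S) = 0}, ‖z‖ₑ

/-- The multiplicative probability `B_{S,p}`: mass `μ_S(p) p^|x|` at each `x ∈ M_S`. -/
def multProb (S : Finset σ) (p : ℝ) : Measure (TraceMonoid R) :=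
  Measure.sum fun x : subTraces R S =>
    ENNReal.ofReal ((mobius R S).eval p * p ^ length (x : TraceMonoid R)) •
      Measure.dirac (x : TraceMonoid R)

/-- The link `Lk(a)`: all letters `b` with `(a, b) ∈ R`. -/
def link [Fintype σ] (a : σ) : Finset σ := Finset.univ.filter fun b => R a b

/-- The parameter `r = 1 - μ_S(p) / μ_{S∖{a}}(p)`. -/
def geomParam (S : Finset σ) (p : ℝ) (a : σ) : ℝ :=
  1 - (mobius R S).eval p / (mobius R (S \ {a})).eval p

end Mobius

/-- The geometric law with `P(K = k) = (1 - r) r^k`. The value for `r ∉ [0, 1)` is a placeholder. -/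
def geometric (r : ℝ) : PMF ℕ :=
  if h : 0 ≤ r ∧ r < 1 then
    ⟨fun k => ENNReal.ofReal ((1 - r) * r ^ k), by
      have hs : HasSum (fun k : ℕ => (1 - r) * r ^ k) 1 := by
        have h1 := (hasSum_geometric_of_lt_one h.1 h.2).mul_left (1 - r)
        rwa [mul_inv_cancel₀ (by linarith [h.2])] at h1
      have hn : ∀ k : ℕ, 0 ≤ (1 - r) * r ^ k := fun k =>
        mul_nonneg (by linarith [h.2]) (pow_nonneg h.1 k)
      have ht := ENNReal.ofReal_tsum_of_nonneg hn hs.summable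
      rw [hs.tsum_eq, ENNReal.ofReal_one] at ht
      rw [ht]
      exact ENNReal.summable.hasSum⟩
  else PMF.pure 0

section Timed

universe v w

/-- The joint law of the result and of the number of steps of a terminating random computation. -/
abbrev Timed (α : Type v) : Type v := PMF (α × ℕ)

/-- Return a value, without any step. -/
def Timed.ret {α : Type v} (a : α) : Timed α := PMF.pure (a, 0)

/-- Spend `n` steps, then run `m`. -/
def Timed.tick {α : Type v} (n : ℕ) (m : Timed α) : Timed α := m.map fun x => (x.1, n + x.2)

/-- Run `m`, then `f` on its result, with fresh randomness; the steps add up. -/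
def Timed.bind {α : Type v} {β : Type w} (m : Timed α) (f : α → Timed β) : Timed β :=
  PMF.bind m fun x => (f x.1).map fun y => (y.1, x.2 + y.2)

/-- `for i = 0 to K - 1 do s ← body i s`, starting with `s = init`. -/
def Timed.forLoop {α : Type v} (body : ℕ → α → Timed α) (init : α) : ℕ → Timed α
  | 0 => Timed.ret init
  | K + 1 => Timed.bind (Timed.forLoop body init K) (body K)

end Timed

/-- The (constant) numbers of steps of the elementary operations: a function call, the test
`S ∩ T = ∅`, the choice of an element of `S ∩ T`, the evaluation of `r` from precomputed values,
a variable assignment, a multiplication in the monoid, the loop control, and a return. -/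
structure OpCosts where
  call : ℕ
  test : ℕ
  choose : ℕ
  arith : ℕ
  assign : ℕ
  mul : ℕ
  loop : ℕ
  ret : ℕ

section Algorithm

variable {σ : Type u} [Fintype σ] [DecidableEq σ] (R : σ → σ → Prop) [DecidableRel R]

/-- A resolution of all the instructions "choose `a ∈ S ∩ T`" in an execution on input `(S, T)`. The
choices are arbitrary, and those made inside a recursive call may depend on the values of the
variables at the time of the call: on `K`, `i` and `ξ` in the `i`-th pass of the loop, and on
`K` and `ξ` in the last call. -/
inductive Choices : Finset σ → Finset σ → Type u
  | halt {S T : Finset σ} (h : S ∩ T = ∅) : Choices S T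
  | step {S T : Finset σ} (a : σ) (ha : a ∈ S ∩ T)
      (V : ℕ → ℕ → TraceMonoid R → Choices (S \ {a}) (link R a))
      (U : ℕ → TraceMonoid R → Choices (S \ {a}) T) : Choices S T

variable {R}

/-- The recursive sampling algorithm on input `(S, T)`, with parameter `p`; `draw k` is the number of
steps of the routine for random integers when it outputs `k`. -/
def run (c : OpCosts) (draw : ℕ → ℕ) (p : ℝ) :
    {S T : Finset σ} → Choices R S T → Timed (TraceMonoid R)
  | _, _, .halt _ =>
      -- return the unit
      Timed.tick (c.call + c.test + c.ret) (Timed.ret 1)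
  | S, _, .step a _ V U =>
      -- choose `a`; `r ← 1 - μ_S(p) / μ_{S∖{a}}(p)`
      Timed.tick (c.call + c.test + c.choose + c.arith + c.assign) <|
      -- `K ← G(r)`
      Timed.bind ((geometric (geomParam R S p a)).map
          fun K => (K, c.call + draw K + c.assign)) fun K =>
      -- `ξ ← 1`; for `i = 0` to `K - 1`: `v ←` output on `(S∖{a}, Lk(a))`; `ξ ← ξ · v · a`
      Timed.tick (c.assign + c.loop) <|
      Timed.bind (Timed.forLoop (fun i ξ =>
          Timed.bind (run c draw p (V K i ξ)) fun v =>
            Timed.tick (c.assign + 2 * c.mul + c.assign + c.loop)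
              (Timed.ret (ξ * v * letter R a))) 1 K) fun ξ =>
      -- `u ←` output on `(S∖{a}, T)`; `ξ ← ξ · u`; return `ξ`
      Timed.bind (run c draw p (U K ξ)) fun u =>
        Timed.tick (c.assign + c.mul + c.assign + c.ret) (Timed.ret (ξ * u))

/-- The law of the output of the algorithm. -/
def outputLaw (c : OpCosts) (draw : ℕ → ℕ) (p : ℝ) {S T : Finset σ} (d : Choices R S T) :
    Measure (TraceMonoid R) :=
  ((run c draw p d).map Prod.fst).toMeasure

end Algorithm

end TraceSampling

end

noncomputable section

namespace TraceSampling

open MeasureTheory Polynomial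
open scoped ENNReal

/-! ### Trace monoids: words, length, letter counts -/

section Traces

variable {σ : Type u} {R : σ → σ → Prop}

/-! Fix `a ∈ S ∩ T`. Every trace factors uniquely as `y * v`, where `y` is a pyramid (no maximal
label other than `a`) and `v` avoids `a`. A pyramid with `k + 1` letters `a` is uniquely `y * v *
a`, with `y` a pyramid having `k` of them and `v` over `S \ {a}` with maximal labels in `Lk(a)`. The
loop and the last call of the algorithm follow these two factorizations (`mem_pyramids_succ_iff`,
`mem_tracesWithMax_and_count_iff`, `pyramids_mul_inj`).

By induction on the resolution of choices, the output on `(S, T)` has mass `μ_S(p) / μ_{S∖T}(p) *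
p^|x|` at each admissible `x` (`isMultiplicativeOn_run`). The identity `μ_S = μ_{S∖a} - X
μ_{S∖Lk(a)}` makes the constants match: `r` is `p` divided by the constant of the call on `(S∖a,
Lk(a))`, so `k` passes produce a factor `r⁻ᵏ`, which the geometric law cancels. No series is summed:
for `T = Σ` the output law is `B_{S,p}`, which is therefore a probability.

Steps are charged to letters: each pass appends at least the letter `a`, and each level of recursion
removes a letter from the alphabet (`steps_run_le`). -/

theorem letter_mul_comm {a b : σ} (h : ¬ R a b) :
    letter R a * letter R b = letter R b * letter R a :=
  PresentedMonoid.mk_eq_mk_of_rel (CommRel.swap a b h)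

@[simp] theorem ofWord_nil : ofWord R [] = 1 := rfl

theorem ofWord_append (w w' : List σ) : ofWord R (w ++ w') = ofWord R w * ofWord R w' := by
  simp [ofWord]

@[simp] theorem ofWord_singleton (a : σ) : ofWord R [a] = letter R a := by
  simp [ofWord]

theorem ofWord_surjective : Function.Surjective (ofWord R) := by
  intro x
  obtain ⟨w, rfl⟩ := PresentedMonoid.surjective_mk x
  induction w using FreeMonoid.inductionOn with
  | one => exact ⟨[], by simp⟩
  | of a => exact ⟨[a], by simp; rfl⟩
  | mul v w hv hw =>
    obtain ⟨v', hv⟩ := hv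
    obtain ⟨w', hw⟩ := hw
    exact ⟨v' ++ w', by rw [ofWord_append, hv, hw, map_mul]⟩

instance [Countable σ] : Countable (TraceMonoid R) :=
  ofWord_surjective.countable

/-- Induction on traces, adding one letter on the right at a time. -/
theorem trace_induction {P : TraceMonoid R → Prop} (one : P 1)
    (mul : ∀ x a, P x → P (x * letter R a)) (x : TraceMonoid R) : P x := by
  obtain ⟨w, rfl⟩ := ofWord_surjective x
  induction w using List.reverseRecOn with
  | nil => exact one
  | append_singleton w a ih =>
    rw [ofWord_append, ofWord_singleton]
    exact mul _ _ ih

theorem trace_cases (x : TraceMonoid R) : x = 1 ∨ ∃ y a, x = y * letter R a := by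
  induction x using trace_induction with
  | one => exact .inl rfl
  | mul x a _ => exact .inr ⟨x, a, rfl⟩

@[simp] theorem length_one : length (1 : TraceMonoid R) = 0 := by simp [length]

@[simp] theorem length_mul (x y : TraceMonoid R) : length (x * y) = length x + length y := by
  simp [length]

@[simp] theorem length_letter (a : σ) : length (letter R a) = 1 := rfl

section Count

variable [DecidableEq σ]

/-- The number of occurrences of a letter in a trace, as a monoid homomorphism. -/
def countHom (R : σ → σ → Prop) (a : σ) : TraceMonoid R →* Multiplicative ℕ :=
  PresentedMonoid.lift (fun b : σ => Multiplicative.ofAdd (if b = a then 1 else 0)) (by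
    rintro _ _ ⟨b, c, h⟩
    simp [mul_comm])

/-- The number of occurrences of a letter in a trace. -/
def count (a : σ) (x : TraceMonoid R) : ℕ := (countHom R a x).toAdd

@[simp] theorem count_one (a : σ) : count a (1 : TraceMonoid R) = 0 := by simp [count]

@[simp] theorem count_mul (a : σ) (x y : TraceMonoid R) :
    count a (x * y) = count a x + count a y := by
  simp [count]

@[simp] theorem count_letter (a b : σ) : count a (letter R b) = if b = a then 1 else 0 := rfl

theorem mem_subTraces_iff {S : Finset σ} {x : TraceMonoid R} :
    x ∈ subTraces R S ↔ ∀ a ∉ S, count a x = 0 := by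
  constructor
  · intro hx a ha
    induction hx using Submonoid.closure_induction with
    | mem x hx =>
      obtain ⟨b, hb, rfl⟩ := hx
      have : b ≠ a := by rintro rfl; exact ha hb
      simp [this]
    | one => simp
    | mul x y _ _ hx hy => simp [hx, hy]
  · induction x using trace_induction with
    | one => intro; exact one_mem _
    | mul x b ih =>
      intro h
      refine mul_mem (ih fun a ha => ?_) (Submonoid.subset_closure ⟨b, ?_, rfl⟩)
      · have := h a ha
        rw [count_mul] at this
        omega
      · by_contra hb
        simpa using h b hb

theorem mul_mem_subTraces_iff {S : Finset σ} {x y : TraceMonoid R} :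
    x * y ∈ subTraces R S ↔ x ∈ subTraces R S ∧ y ∈ subTraces R S := by
  simp only [mem_subTraces_iff, count_mul, Nat.add_eq_zero_iff]
  exact ⟨fun h => ⟨fun a ha => (h a ha).1, fun a ha => (h a ha).2⟩,
    fun h a ha => ⟨h.1 a ha, h.2 a ha⟩⟩

theorem letter_mem_subTraces_iff {S : Finset σ} {a : σ} :
    letter R a ∈ subTraces R S ↔ a ∈ S := by
  rw [mem_subTraces_iff]
  constructor
  · intro h
    by_contra ha
    simpa using h a ha
  · intro ha b hb
    have : a ≠ b := by rintro rfl; exact hb ha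
    simp [this]

theorem mem_subTraces_sdiff_singleton {S : Finset σ} {a : σ} {x : TraceMonoid R} :
    x ∈ subTraces R (S \ {a}) ↔ x ∈ subTraces R S ∧ count a x = 0 := by
  simp only [mem_subTraces_iff, Finset.mem_sdiff, Finset.mem_singleton, not_and, not_not]
  constructor
  · exact fun h => ⟨fun b hb => h b fun hb' => absurd hb' hb, h a fun _ => rfl⟩
  · rintro ⟨h, ha⟩ b hb
    by_cases hbS : b ∈ S
    · rw [hb hbS, ha]
    · exact h b hbS

end Count

/-! ### Right quotients by a letter and cancellation -/

section Derivative

variable [DecidableEq σ] [DecidableRel R]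

/-- The effect of appending the letter `c` to a trace `s.1` whose right quotient by the letter `b`,
if any, is `s.2`. -/
def derivStep (R : σ → σ → Prop) [DecidableRel R] (b c : σ)
    (s : TraceMonoid R × Option (TraceMonoid R)) : TraceMonoid R × Option (TraceMonoid R) :=
  (s.1 * letter R c,
    if c = b then some s.1 else if R b c then none else s.2.map (· * letter R c))

theorem derivStep_comm (hr : ∀ a, R a a) (hs : ∀ a b, R a b → R b a) (b c d : σ) (h : ¬ R c d)
    (s : TraceMonoid R × Option (TraceMonoid R)) :
    derivStep R b d (derivStep R b c s) = derivStep R b c (derivStep R b d s) := by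
  have hcd := letter_mul_comm h
  -- Reflexivity of `R` excludes `c = d`, so at most one of the two letters is `b`.
  have hne : c ≠ d := by rintro rfl; exact h (hr c)
  have h' : ¬ R d c := fun h' => h (hs _ _ h')
  obtain ⟨x, o⟩ := s
  ext1
  · simp [derivStep, mul_assoc, hcd]
  · by_cases hc : c = b
    · subst hc
      simp [derivStep, hne.symm, h]
    by_cases hd : d = b
    · subst hd
      simp [derivStep, hne, h']
    by_cases h1 : R b c <;> by_cases h2 : R b d <;> cases o <;>
      simp [derivStep, hc, hd, h1, h2, mul_assoc, hcd]

/-- The right action of traces generated by `derivStep`. -/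
def derivHom (hr : ∀ a, R a a) (hs : ∀ a b, R a b → R b a) (b : σ) :
    TraceMonoid R →* (Function.End (TraceMonoid R × Option (TraceMonoid R)))ᵐᵒᵖ :=
  PresentedMonoid.lift (M := (Function.End (TraceMonoid R × Option (TraceMonoid R)))ᵐᵒᵖ)
    (fun c : σ => MulOpposite.op (derivStep R b c)) (by
    rintro _ _ ⟨c, d, h⟩
    simp only [map_mul, FreeMonoid.lift_eval_of]
    refine MulOpposite.unop_injective (funext fun s => ?_)
    exact derivStep_comm hr hs b c d h s)

/-- The right quotient of a trace by a letter, if it exists. -/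
def deriv (hr : ∀ a, R a a) (hs : ∀ a b, R a b → R b a) (b : σ) (x : TraceMonoid R) :
    Option (TraceMonoid R) :=
  ((derivHom hr hs b x).unop (1, none)).2

variable (hr : ∀ a, R a a) (hs : ∀ a b, R a b → R b a)
include hr hs

theorem derivHom_mul_letter (b c : σ) (x : TraceMonoid R)
    (s : TraceMonoid R × Option (TraceMonoid R)) :
    (derivHom hr hs b (x * letter R c)).unop s =
      derivStep R b c ((derivHom hr hs b x).unop s) := by
  rw [map_mul, MulOpposite.unop_mul]
  rfl

theorem derivHom_fst (b : σ) (x : TraceMonoid R) :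
    ((derivHom hr hs b x).unop (1, none)).1 = x := by
  induction x using trace_induction with
  | one => rw [map_one]; rfl
  | mul x c ih => rw [derivHom_mul_letter, derivStep, ih]

theorem deriv_mul_letter (b c : σ) (x : TraceMonoid R) :
    deriv hr hs b (x * letter R c) =
      if c = b then some x else
        if R b c then none else (deriv hr hs b x).map (· * letter R c) := by
  rw [deriv, derivHom_mul_letter, derivStep, derivHom_fst]
  rfl

theorem eq_mul_letter_of_deriv_eq_some {b : σ} {x y : TraceMonoid R}
    (h : deriv hr hs b x = some y) : x = y * letter R b := by
  induction x using trace_induction generalizing y with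
  | one => rw [deriv, map_one] at h; cases h
  | mul x c ih =>
    rw [deriv_mul_letter] at h
    split_ifs at h with hcb hR
    · cases h; rw [hcb]
    · obtain ⟨z, hz, rfl⟩ := Option.map_eq_some_iff.1 h
      rw [ih hz, mul_assoc, mul_assoc, letter_mul_comm hR]

/-- Two factorizations of a trace with one letter on the right agree or differ by a commutation. -/
theorem mul_letter_eq_mul_letter {a b : σ} {x y : TraceMonoid R}
    (h : x * letter R a = y * letter R b) :
    (a = b ∧ x = y) ∨ (a ≠ b ∧ ¬ R b a ∧ ∃ z, x = z * letter R b ∧ y = z * letter R a) := by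
  -- The quotient by `b` of the common trace, computed from both factorizations.
  have h1 := deriv_mul_letter hr hs b a x
  rw [h, deriv_mul_letter, if_pos rfl] at h1
  split_ifs at h1 with hab hR
  · exact .inl ⟨hab, (Option.some.inj h1).symm⟩
  · obtain ⟨z, hz, rfl⟩ := Option.map_eq_some_iff.1 h1.symm
    exact .inr ⟨hab, hR, z, eq_mul_letter_of_deriv_eq_some hr hs hz, rfl⟩

theorem mul_letter_right_cancel {a : σ} {x y : TraceMonoid R}
    (h : x * letter R a = y * letter R a) : x = y := by
  obtain ⟨_, h⟩ | ⟨h, _⟩ := mul_letter_eq_mul_letter hr hs h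
  · exact h
  · exact absurd rfl h

end Derivative

/-! ### Maximal labels and the unique factorization at a letter -/

section MaxLabels

theorem commute_ofWord {a : σ} {w : List σ} (h : ∀ b ∈ w, ¬ R a b) :
    letter R a * ofWord R w = ofWord R w * letter R a := by
  induction w with
  | nil => simp
  | cons b w ih =>
    have hw : ofWord R (b :: w) = letter R b * ofWord R w := by simp [ofWord]
    rw [hw, ← mul_assoc, letter_mul_comm (h b (by simp)), mul_assoc,
      ih fun c hc => h c (by simp [hc]), mul_assoc]

/-- The maximal labels of a trace are the letters by which it is divisible on the right. -/
theorem mem_maxLabels_iff {a : σ} {x : TraceMonoid R} :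
    a ∈ maxLabels x ↔ ∃ y, x = y * letter R a := by
  constructor
  · rintro ⟨w, rfl, i, rfl, hi⟩
    -- Maximality of `i` means that no later letter is `R`-related to its label, which can thus be
    -- moved to the end of the word.
    refine ⟨ofWord R (w.take i) * ofWord R (w.drop (i + 1)), ?_⟩
    have hw : w = w.take i ++ [w.get i] ++ w.drop (i + 1) := by simp
    conv_lhs => rw [hw]
    rw [ofWord_append, ofWord_append, ofWord_singleton, mul_assoc, mul_assoc, commute_ofWord]
    intro b hb hR
    obtain ⟨j, hj, rfl⟩ := List.mem_iff_getElem.1 hb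
    rw [List.getElem_drop] at hR
    rw [List.length_drop] at hj
    have := hi ⟨i + 1 + j, by omega⟩
      (Relation.ReflTransGen.single ⟨Fin.le_def.2 (by simp; omega), hR⟩)
    have := congrArg Fin.val this
    simp at this
    omega
  · rintro ⟨y, rfl⟩
    obtain ⟨w, rfl⟩ := ofWord_surjective y
    refine ⟨w ++ [a], by rw [ofWord_append, ofWord_singleton],
      ⟨w.length, by simp⟩, by simp, fun j hj => ?_⟩
    induction hj with
    | refl => rfl
    | tail _ h ih =>
      subst ih
      rename_i k _
      have h1 := Fin.le_def.1 h.1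
      have h2 := k.2
      simp at h1 h2
      ext
      simp
      omega

theorem maxLabels_one : maxLabels (1 : TraceMonoid R) = ∅ := by
  ext a
  simp only [mem_maxLabels_iff, Set.mem_empty_iff_false, iff_false]
  rintro ⟨y, hy⟩
  have := congrArg length hy
  simp at this

theorem maxLabels_right_subset (x y : TraceMonoid R) : maxLabels y ⊆ maxLabels (x * y) := by
  intro a ha
  obtain ⟨z, rfl⟩ := mem_maxLabels_iff.1 ha
  exact mem_maxLabels_iff.2 ⟨x * z, (mul_assoc _ _ _).symm⟩

theorem mem_maxLabels_mul_letter (x : TraceMonoid R) (a : σ) : a ∈ maxLabels (x * letter R a) :=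
  mem_maxLabels_iff.2 ⟨x, rfl⟩

theorem mem_of_mem_maxLabels [DecidableEq σ] {S : Finset σ} {x : TraceMonoid R}
    (hx : x ∈ subTraces R S) {a : σ} (ha : a ∈ maxLabels x) : a ∈ S := by
  obtain ⟨y, rfl⟩ := mem_maxLabels_iff.1 ha
  exact letter_mem_subTraces_iff.1 (mul_mem_subTraces_iff.1 hx).2

theorem mem_maxLabels_mul_letter_of_not {x : TraceMonoid R} {a b : σ} (hb : b ∈ maxLabels x)
    (h : ¬ R b a) : b ∈ maxLabels (x * letter R a) := by
  obtain ⟨y, rfl⟩ := mem_maxLabels_iff.1 hb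
  exact mem_maxLabels_iff.2 ⟨y * letter R a, by rw [mul_assoc, letter_mul_comm h, mul_assoc]⟩

variable [DecidableEq σ] [DecidableRel R] (hr : ∀ a, R a a) (hs : ∀ a b, R a b → R b a)
include hr hs

theorem mem_maxLabels_of_mul_letter {x : TraceMonoid R} {a b : σ}
    (h : b ∈ maxLabels (x * letter R a)) : b = a ∨ (b ∈ maxLabels x ∧ ¬ R b a) := by
  obtain ⟨y, hy⟩ := mem_maxLabels_iff.1 h
  obtain ⟨h, _⟩ | ⟨_, hR, z, hz, _⟩ := mul_letter_eq_mul_letter hr hs hy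
  · exact .inl h.symm
  · exact .inr ⟨mem_maxLabels_iff.2 ⟨z, hz⟩, hR⟩

theorem maxLabels_mul_subset (x y : TraceMonoid R) :
    maxLabels (x * y) ⊆ maxLabels x ∪ maxLabels y := by
  induction y using trace_induction with
  | one => simp
  | mul y a ih =>
    intro b hb
    rw [← mul_assoc] at hb
    obtain rfl | ⟨hb, hR⟩ := mem_maxLabels_of_mul_letter hr hs hb
    · exact .inr (mem_maxLabels_mul_letter y b)
    · obtain hb | hb := ih hb
      · exact .inl hb
      · exact .inr (mem_maxLabels_mul_letter_of_not hb hR)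

omit [DecidableRel R] hr hs in
/-- Every trace is the product of a trace with no maximal label other than `a` and of a trace
without `a`. -/
theorem exists_mul_of_maxLabels_subset_singleton (a : σ) (x : TraceMonoid R) :
    ∃ y v, x = y * v ∧ maxLabels y ⊆ {a} ∧ count a v = 0 := by
  induction h : length x using Nat.strong_induction_on generalizing x with
  | _ n ih =>
    by_cases hx : maxLabels x ⊆ {a}
    · exact ⟨x, 1, (mul_one x).symm, hx, count_one a⟩
    · obtain ⟨b, hb, hba⟩ := Set.not_subset.1 hx
      -- Strip a maximal letter `b ≠ a`, factor the shorter trace, and put `b` back into the second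
      -- factor.
      obtain ⟨z, rfl⟩ := mem_maxLabels_iff.1 hb
      obtain ⟨y, v, rfl, hy, hv⟩ := ih (length z) (by rw [← h]; simp) z rfl
      refine ⟨y, v * letter R b, mul_assoc _ _ _, hy, ?_⟩
      have : b ≠ a := hba
      simp [hv, this]

/-- The last letter `b ≠ a` of `v` is maximal in `y' * v'` but not in `y'`, hence is maximal in
`v'`; cancel it on both sides and repeat. -/
theorem eq_and_eq_of_mul_eq_mul {a : σ} {y y' v v' : TraceMonoid R} (hy : maxLabels y ⊆ {a})
    (hy' : maxLabels y' ⊆ {a}) (hv : count a v = 0) (hv' : count a v' = 0)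
    (h : y * v = y' * v') : y = y' ∧ v = v' := by
  have ne_of_count {z : TraceMonoid R} {b : σ} (hz : count a (z * letter R b) = 0) : b ≠ a := by
    rintro rfl
    simp at hz
  induction v using trace_induction generalizing v' with
  | one =>
    obtain rfl | ⟨z, b, rfl⟩ := trace_cases v'
    · simpa using h
    · refine absurd (hy (mem_maxLabels_iff.2 ⟨y' * z, ?_⟩)) (ne_of_count hv')
      rw [mul_assoc, ← h, mul_one]
  | mul v b ih =>
    have hb := ne_of_count hv
    have key : b ∈ maxLabels v' := by
      have h1 : b ∈ maxLabels (y' * v') := by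
        rw [← h, ← mul_assoc]
        exact mem_maxLabels_mul_letter _ _
      exact (maxLabels_mul_subset hr hs y' v' h1).resolve_left fun h1 => hb (hy' h1)
    obtain ⟨z, rfl⟩ := mem_maxLabels_iff.1 key
    rw [← mul_assoc, ← mul_assoc] at h
    rw [count_mul] at hv hv'
    obtain ⟨h1, h2⟩ := ih (by omega) (by omega) (mul_letter_right_cancel hr hs h)
    exact ⟨h1, by rw [h2]⟩

end MaxLabels

end Traces

/-! ### Möbius polynomials: recursion and positivity -/

section Mobius

variable {σ : Type u} [DecidableEq σ] {R : σ → σ → Prop} [DecidableRel R]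

@[simp] theorem mobius_empty : mobius R (∅ : Finset σ) = 1 := by
  simp [mobius, Finset.filter_singleton]

theorem mobius_eval_zero (S : Finset σ) : (mobius R S).eval 0 = 1 := by
  rw [mobius, eval_finsetSum, Finset.sum_eq_single ∅]
  · simp
  · intro γ _ hγ
    simp [Finset.card_ne_zero.2 (Finset.nonempty_iff_ne_empty.2 hγ)]
  · simp

/-- The term of the Möbius polynomial given by a set of letters; it is zero if the set is not a
clique. -/
def cliqueTerm (R : σ → σ → Prop) [DecidableRel R] (γ : Finset σ) : ℝ[X] :=
  if ∀ a ∈ γ, ∀ b ∈ γ, a ≠ b → ¬ R a b then (-1) ^ γ.card * X ^ γ.card else 0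

theorem mobius_eq_sum_cliqueTerm (S : Finset σ) :
    mobius R S = ∑ γ ∈ S.powerset, cliqueTerm R γ :=
  Finset.sum_filter _ _

theorem cliqueTerm_insert (hs : ∀ a b, R a b → R b a) {γ : Finset σ} {a : σ} (ha : a ∉ γ)
    (h : ∀ b ∈ γ, ¬ R a b) : cliqueTerm R (insert a γ) = -(X * cliqueTerm R γ) := by
  have hiff : (∀ b ∈ insert a γ, ∀ c ∈ insert a γ, b ≠ c → ¬ R b c) ↔
      ∀ b ∈ γ, ∀ c ∈ γ, b ≠ c → ¬ R b c := by
    refine ⟨fun h' b hb c hc => h' b (by simp [hb]) c (by simp [hc]), fun h' b hb c hc hbc => ?_⟩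
    obtain hba | hb := Finset.mem_insert.1 hb <;> obtain hca | hc := Finset.mem_insert.1 hc
    · exact absurd (hba.trans hca.symm) hbc
    · exact hba ▸ h c hc
    · exact fun hR => h b hb (hs _ _ (hca ▸ hR))
    · exact h' b hb c hc hbc
  unfold cliqueTerm
  rw [Finset.card_insert_of_notMem ha]
  by_cases hγ : ∀ b ∈ γ, ∀ c ∈ γ, b ≠ c → ¬ R b c
  · rw [if_pos hγ, if_pos (hiff.2 hγ)]
    ring
  · rw [if_neg hγ, if_neg (mt hiff.1 hγ), mul_zero, neg_zero]

/-- The recursion on the alphabet satisfied by the Möbius polynomials: a clique with the letter `a`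
is `a` and a clique of letters commuting with `a`. -/
theorem mobius_eq_sub [Fintype σ] (hr : ∀ a, R a a) (hs : ∀ a b, R a b → R b a) {S : Finset σ}
    {a : σ} (ha : a ∈ S) :
    mobius R S = mobius R (S \ {a}) - X * mobius R (S \ link R a) := by
  have hS : S = insert a (S \ {a}) := by
    rw [Finset.sdiff_singleton_eq_erase, Finset.insert_erase ha]
  have haS : a ∉ S \ {a} := by simp
  have halink : a ∈ link R a := by simp [link, hr]
  simp only [mobius_eq_sum_cliqueTerm]
  conv_lhs => rw [hS, Finset.sum_powerset_insert haS]
  rw [sub_eq_add_neg, Finset.mul_sum, ← Finset.sum_neg_distrib]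
  congr 1
  symm
  -- Subsets of `S \ {a}` that meet the link of `a` are no longer cliques once `a` is added, so
  -- their terms vanish.
  refine (Finset.sum_congr rfl fun γ hγ => ?_).trans (Finset.sum_subset
    (f := fun γ => cliqueTerm R (insert a γ)) (Finset.powerset_mono.2
      (Finset.sdiff_subset_sdiff subset_rfl (Finset.singleton_subset_iff.2 halink)))
    fun γ hγ hγ' => ?_)
  · rw [Finset.mem_powerset] at hγ
    refine (cliqueTerm_insert hs (fun h => (Finset.mem_sdiff.1 (hγ h)).2 halink)
      fun b hb hR => (Finset.mem_sdiff.1 (hγ hb)).2 ?_).symm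
    simp [link, hR]
  · rw [Finset.mem_powerset] at hγ hγ'
    obtain ⟨b, hb, hb'⟩ := Finset.not_subset.1 hγ'
    have hbS := Finset.mem_sdiff.1 (hγ hb)
    refine if_neg fun h => h a (by simp) b (by simp [hb]) ?_ ?_
    · exact fun hab => hbS.2 (by simp [hab])
    · by_contra hR
      exact hb' (Finset.mem_sdiff.2 ⟨hbS.1, by simp [link, hR]⟩)

theorem mobius_eval_ne_zero_of_lt_smallestRoot {S : Finset σ} {p t : ℝ} (h0 : 0 ≤ t) (h : t ≤ p)
    (hp : ENNReal.ofReal p < smallestRoot R S) : (mobius R S).eval t ≠ 0 := by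
  intro ht
  refine absurd hp (not_lt.2 ?_)
  refine (iInf₂_le (t : ℂ) ?_).trans ?_
  · have := aeval_algebraMap_apply ℂ t (mobius R S)
    simp only [Complex.coe_algebraMap] at this
    rw [Set.mem_ofPred_eq, this, aeval_def, Algebra.algebraMap_self, eval₂_id, ht]
    simp
  · rw [← ofReal_norm, Complex.norm_real, Real.norm_of_nonneg h0]
    exact ENNReal.ofReal_le_ofReal h

/-- Below the smallest root of the Möbius polynomial of the whole alphabet, the Möbius polynomials
of all the subalphabets are positive. -/
theorem mobius_eval_pos [Fintype σ] (hr : ∀ a, R a a) (hs : ∀ a b, R a b → R b a) {p : ℝ}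
    (h0 : 0 < p) (hp : ENNReal.ofReal p < smallestRoot R Finset.univ) (S : Finset σ) :
    0 < (mobius R S).eval p := by
  -- At a zero `t` of this minimum every `μ_S(t)` is nonnegative and some vanish.
  let g : ℝ → ℝ := fun t => Finset.univ.inf' Finset.univ_nonempty
    fun S : Finset σ => (mobius R S).eval t
  have hg : Continuous g := by
    apply Continuous.finset_inf'_apply
    intro S _
    exact (mobius R S).continuous
  have hg0 : g 0 = 1 := by simp [g, mobius_eval_zero]
  suffices h : 0 < g p from h.trans_le (Finset.inf'_le _ (Finset.mem_univ S))
  by_contra! hgp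
  obtain ⟨t, ⟨ht0, htp⟩, ht⟩ := intermediate_value_Icc' h0.le hg.continuousOn
    (show (0 : ℝ) ∈ Set.Icc (g p) (g 0) from ⟨hgp, by simp [hg0]⟩)
  have hnonneg : ∀ S : Finset σ, 0 ≤ (mobius R S).eval t := fun S =>
    ht ▸ Finset.inf'_le (fun S : Finset σ => (mobius R S).eval t) (Finset.mem_univ S)
  obtain ⟨S₀, _, hS₀⟩ := Finset.exists_mem_eq_inf' (s := Finset.univ) Finset.univ_nonempty
    fun S : Finset σ => (mobius R S).eval t
  have hS₀ : (mobius R S₀).eval t = 0 := hS₀.symm.trans ht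
  -- A maximal `M` with `μ_M(t) = 0` is not the whole alphabet. Adding a letter, the recursion makes
  -- the next value at most `0`, hence `0`, against maximality.
  obtain ⟨M, hM⟩ := (Set.toFinite {S : Finset σ | (mobius R S).eval t = 0}).exists_maximal
    ⟨S₀, hS₀⟩
  have hMu : M ≠ Finset.univ := by
    rintro rfl
    exact mobius_eval_ne_zero_of_lt_smallestRoot ht0 htp hp hM.prop
  obtain ⟨a, ha⟩ : ∃ a, a ∉ M := by
    by_contra! h
    exact hMu (Finset.eq_univ_iff_forall.2 h)
  have hrec := congrArg (eval t) (mobius_eq_sub hr hs (Finset.mem_insert_self a M))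
  rw [Finset.sdiff_singleton_eq_erase, Finset.erase_insert ha, eval_sub, eval_mul, eval_X,
    (hM.prop : eval t (mobius R M) = 0)] at hrec
  have h1 := mul_nonneg ht0 (hnonneg (insert a M \ link R a))
  have h2 : (mobius R (insert a M)).eval t = 0 :=
    le_antisymm (by linarith) (hnonneg _)
  exact ha (hM.le_of_ge h2 (Finset.subset_insert a M) (Finset.mem_insert_self a M))

variable [Fintype σ]

/-- In this form `r` is `p` over the constant of the output law on `(S \ {a}, Lk(a))`. -/
theorem geomParam_eq (hr : ∀ a, R a a) (hs : ∀ a b, R a b → R b a) {p : ℝ}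
    (hpos : ∀ S : Finset σ, 0 < (mobius R S).eval p) {S : Finset σ} {a : σ} (ha : a ∈ S) :
    geomParam R S p a =
      p * (mobius R (S \ link R a)).eval p / (mobius R (S \ {a})).eval p := by
  have := (hpos (S \ {a})).ne'
  rw [geomParam, mobius_eq_sub hr hs ha, eval_sub, eval_mul, eval_X]
  field_simp
  ring

theorem geomParam_mem (hr : ∀ a, R a a) (hs : ∀ a b, R a b → R b a) {p : ℝ} (h0 : 0 < p)
    (hpos : ∀ S : Finset σ, 0 < (mobius R S).eval p) {S : Finset σ} {a : σ} (ha : a ∈ S) :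
    0 < geomParam R S p a ∧ geomParam R S p a < 1 := by
  constructor
  · rw [geomParam_eq hr hs hpos ha]
    exact div_pos (mul_pos h0 (hpos _)) (hpos _)
  · have := div_pos (hpos S) (hpos (S \ {a}))
    rw [geomParam]
    linarith

end Mobius

section Choices

variable {σ : Type u} [Fintype σ] [DecidableEq σ] (R : σ → σ → Prop) [DecidableRel R]

theorem nonempty_choices (S T : Finset σ) : Nonempty (Choices R S T) := by
  induction h : S.card using Nat.strong_induction_on generalizing S T with
  | _ n ih =>
    by_cases hST : S ∩ T = ∅
    · exact ⟨.halt hST⟩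
    · obtain ⟨a, ha⟩ := Finset.nonempty_iff_ne_empty.2 hST
      have hcard : (S \ {a}).card < n := by
        rw [← h, Finset.sdiff_singleton_eq_erase]
        exact Finset.card_erase_lt_of_mem (Finset.mem_inter.1 ha).1
      obtain ⟨V⟩ := ih _ hcard (S \ {a}) (link R a) rfl
      obtain ⟨U⟩ := ih _ hcard (S \ {a}) T rfl
      exact ⟨.step a ha (fun _ _ _ => V) fun _ _ => U⟩

end Choices

/-! ### Timed computations and the bound on the number of steps -/

section Timed

universe v w

variable {α : Type v} {β : Type w}

theorem Timed.mem_support_ret {a : α} {e : α × ℕ} :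
    e ∈ (Timed.ret a).support ↔ e = (a, 0) := by
  rw [Timed.ret, PMF.mem_support_pure_iff]

theorem Timed.mem_support_tick {n : ℕ} {m : Timed α} {e : α × ℕ} :
    e ∈ (Timed.tick n m).support ↔ ∃ x ∈ m.support, e = (x.1, n + x.2) := by
  rw [Timed.tick, PMF.mem_support_map_iff]
  simp only [eq_comm]

theorem Timed.mem_support_bind {m : Timed α} {f : α → Timed β} {e : β × ℕ} :
    e ∈ (Timed.bind m f).support ↔
      ∃ x ∈ m.support, ∃ y ∈ (f x.1).support, e = (y.1, x.2 + y.2) := by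
  simp only [Timed.bind, PMF.mem_support_bind_iff, PMF.mem_support_map_iff, eq_comm]

@[simp] theorem Timed.fst_ret (a : α) : (Timed.ret a).map Prod.fst = PMF.pure a :=
  PMF.pure_map _ _

@[simp] theorem Timed.fst_tick (n : ℕ) (m : Timed α) :
    (Timed.tick n m).map Prod.fst = m.map Prod.fst := by
  rw [Timed.tick, PMF.map_comp]
  rfl

@[simp] theorem Timed.fst_bind (m : Timed α) (f : α → Timed β) :
    (Timed.bind m f).map Prod.fst = (m.map Prod.fst).bind fun x => (f x).map Prod.fst := by
  rw [Timed.bind, PMF.map_bind, PMF.bind_map]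
  simp only [PMF.map_comp]
  rfl

end Timed

section Steps

variable {σ : Type u} [Fintype σ] [DecidableEq σ] {R : σ → σ → Prop} [DecidableRel R]

/-- The total cost of one copy of each instruction of the algorithm. -/
def OpCosts.total (c : OpCosts) : ℕ :=
  1 + 2 * c.call + c.test + c.choose + c.arith + 7 * c.assign + 3 * c.mul + 2 * c.loop + c.ret

omit [Fintype σ] [DecidableEq σ] [DecidableRel R] in
-- Here `l` is the length of the `v` of a pass, and `l + 1` counts the appended `a`. The costs `A *
-- (l + 1)` add up to `A` times the final length.
theorem steps_forLoop_le {body : ℕ → TraceMonoid R → Timed (TraceMonoid R)} {A B : ℕ}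
    (hbody : ∀ i ξ, ∀ e ∈ (body i ξ).support, ∃ l, length e.1 = length ξ + (l + 1) ∧
      e.2 ≤ A * (l + 1) + B) (K : ℕ) :
    ∀ e ∈ (Timed.forLoop body 1 K).support,
      K ≤ length e.1 ∧ e.2 ≤ A * length e.1 + K * B := by
  induction K with
  | zero =>
    intro e he
    rw [Timed.forLoop, Timed.mem_support_ret] at he
    simp [he]
  | succ K ih =>
    intro e he
    rw [Timed.forLoop, Timed.mem_support_bind] at he
    obtain ⟨x, hx, y, hy, rfl⟩ := he
    obtain ⟨h1, h2⟩ := ih x hx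
    obtain ⟨l, h3, h4⟩ := hbody K x.1 y hy
    dsimp only
    rw [h3]
    exact ⟨by omega, by linarith [mul_add A (length x.1) (l + 1)]⟩

/-- The recursive calls, on an alphabet smaller by one letter, use at most `c.total * |S| * (|ξ| +
|u| + 1)` steps, where `ξ` is the result of the loop. The remaining `c.total * (|ξ| + |u| + 1)` pays
for the passes and the fixed instructions. -/
theorem steps_run_le (c : OpCosts) {draw : ℕ → ℕ} (hdraw : ∀ k, draw k ≤ k) (p : ℝ)
    {S T : Finset σ} (d : Choices R S T) :
    ∀ e ∈ (run c draw p d).support,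
      e.2 ≤ c.total * ((S.card + 1) * (length e.1 + 1)) := by
  induction d with
  | halt h =>
    intro e he
    rw [run, Timed.mem_support_tick] at he
    obtain ⟨x, hx, rfl⟩ := he
    rw [Timed.mem_support_ret] at hx
    subst hx
    calc c.call + c.test + c.ret + 0 ≤ c.total := by rw [OpCosts.total]; omega
      _ ≤ _ := Nat.le_mul_of_pos_right _ (by positivity)
  | @step S T a ha V U ihV ihU =>
    have hcard : (S \ {a}).card + 1 = S.card := by
      rw [Finset.sdiff_singleton_eq_erase]
      exact Finset.card_erase_add_one (Finset.mem_inter.1 ha).1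
    rw [hcard] at ihV ihU
    intro e he
    simp only [run, Timed.mem_support_tick, Timed.mem_support_bind, PMF.mem_support_map_iff] at he
    obtain ⟨_, ⟨_, ⟨K, _, rfl⟩, _, ⟨_, ⟨ξ, hξ, _, ⟨u, hu, _, ⟨_, hx, rfl⟩, rfl⟩, rfl⟩, rfl⟩, rfl⟩,
      rfl⟩ := he
    rw [Timed.mem_support_ret] at hx
    subst hx
    obtain ⟨h1, h2⟩ := steps_forLoop_le (A := c.total * S.card)
      (B := c.assign + 2 * c.mul + c.assign + c.loop) (by
        intro i ξ e he
        simp only [Timed.mem_support_tick, Timed.mem_support_bind] at he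
        obtain ⟨v, hv, _, ⟨_, hx, rfl⟩, rfl⟩ := he
        rw [Timed.mem_support_ret] at hx
        subst hx
        have := ihV K i ξ v hv
        refine ⟨length v.1, by simp [add_assoc], ?_⟩
        dsimp only
        rw [mul_assoc]
        omega) K ξ hξ
    have h3 := ihU K ξ.1 u hu
    have h4 := hdraw K
    dsimp only
    rw [length_mul]
    -- The extra `1` per pass covers `draw K ≤ K`; it is the `1` in `OpCosts.total`.
    have h5 : K * (1 + (c.assign + 2 * c.mul + c.assign + c.loop)) ≤ length ξ.1 * c.total :=
      Nat.mul_le_mul h1 (by rw [OpCosts.total]; omega)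
    have h6 : c.call + c.test + c.choose + c.arith + c.assign + (c.call + c.assign) +
        (c.assign + c.loop) + (c.assign + c.mul + c.assign + c.ret) ≤ c.total := by
      rw [OpCosts.total]; omega
    have h7 : 0 ≤ c.total * length u.1 := Nat.zero_le _
    nlinarith

end Steps

/-! ### Pyramids and the factorizations behind the algorithm -/

section Factorization

variable {σ : Type u} [DecidableEq σ] {R : σ → σ → Prop}

/-- The traces over `S` whose maximal labels are in `T`. -/
def tracesWithMax (R : σ → σ → Prop) (S T : Finset σ) : Set (TraceMonoid R) :=
  {x | x ∈ subTraces R S ∧ maxLabels x ⊆ T}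

/-- The traces over `S` with no maximal label other than `a` and with `k` occurrences of `a`. -/
def pyramids (R : σ → σ → Prop) (S : Finset σ) (a : σ) (k : ℕ) : Set (TraceMonoid R) :=
  {y | y ∈ subTraces R S ∧ maxLabels y ⊆ {a} ∧ count a y = k}

theorem pyramids_zero (S : Finset σ) (a : σ) : pyramids R S a 0 = {1} := by
  ext y
  constructor
  · rintro ⟨_, hy, h0⟩
    obtain rfl | ⟨z, b, rfl⟩ := trace_cases y
    · rfl
    · obtain rfl : b = a := hy (mem_maxLabels_mul_letter z b)
      simp at h0
  · rintro rfl
    exact ⟨one_mem _, by simp [maxLabels_one], count_one a⟩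

theorem tracesWithMax_of_inter_eq_empty {S T : Finset σ} (h : S ∩ T = ∅) :
    tracesWithMax R S T = {1} := by
  ext x
  constructor
  · rintro ⟨hS, hT⟩
    obtain rfl | ⟨z, b, rfl⟩ := trace_cases x
    · rfl
    · have hb := mem_maxLabels_mul_letter z b
      have : b ∈ S ∩ T := Finset.mem_inter.2 ⟨mem_of_mem_maxLabels hS hb, hT hb⟩
      simp [h] at this
  · rintro rfl
    exact ⟨one_mem _, by simp [maxLabels_one]⟩

variable [DecidableRel R] (hr : ∀ a, R a a) (hs : ∀ a b, R a b → R b a)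
include hr hs

theorem mem_pyramids_succ_iff [Fintype σ] {S : Finset σ} {a : σ} (ha : a ∈ S) {k : ℕ}
    {x : TraceMonoid R} :
    x ∈ pyramids R S a (k + 1) ↔
      ∃ y ∈ pyramids R S a k, ∃ v ∈ tracesWithMax R (S \ {a}) (link R a),
        x = y * v * letter R a := by
  constructor
  · rintro ⟨hxS, hx, hk⟩
    obtain rfl | ⟨z, b, rfl⟩ := trace_cases x
    · simp at hk
    obtain rfl : b = a := hx (mem_maxLabels_mul_letter z b)
    obtain ⟨y, v, rfl, hy, hv⟩ := exists_mul_of_maxLabels_subset_singleton b z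
    rw [mul_mem_subTraces_iff, mul_mem_subTraces_iff] at hxS
    refine ⟨y, ⟨hxS.1.1, hy, by simpa [hv] using hk⟩, v,
      ⟨mem_subTraces_sdiff_singleton.2 ⟨hxS.1.2, hv⟩, fun c hc => ?_⟩, rfl⟩
    simp only [link, Finset.coe_filter, Finset.mem_univ, true_and, Set.mem_ofPred_eq]
    by_contra hR
    -- A maximal letter of `v` outside the link would commute past the final letter and be maximal
    -- in the whole pyramid.
    obtain rfl : c = b := hx (mem_maxLabels_mul_letter_of_not (maxLabels_right_subset y v hc)
      fun h => hR (hs _ _ h))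
    exact hR (hr c)
  · rintro ⟨y, ⟨hyS, hy, hk⟩, v, ⟨hvS, hv⟩, rfl⟩
    rw [mem_subTraces_sdiff_singleton] at hvS
    refine ⟨mul_mem (mul_mem hyS hvS.1) (letter_mem_subTraces_iff.2 ha), fun b hb => ?_,
      by simp [hk, hvS.2]⟩
    obtain rfl | ⟨hb, hR⟩ := mem_maxLabels_of_mul_letter hr hs hb
    · rfl
    · obtain hb | hb := maxLabels_mul_subset hr hs y v hb
      · exact hy hb
      · have := hv hb
        simp only [link, Finset.coe_filter, Finset.mem_univ, true_and, Set.mem_ofPred_eq] at this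
        exact absurd (hs _ _ this) hR

theorem mem_tracesWithMax_and_count_iff {S T : Finset σ} {a : σ} (ha : a ∈ S ∩ T) {k : ℕ}
    {x : TraceMonoid R} :
    x ∈ tracesWithMax R S T ∩ {x | count a x = k} ↔
      ∃ y ∈ pyramids R S a k, ∃ u ∈ tracesWithMax R (S \ {a}) T, x = y * u := by
  constructor
  · rintro ⟨⟨hxS, hx⟩, hk⟩
    obtain ⟨y, u, rfl, hy, hu⟩ := exists_mul_of_maxLabels_subset_singleton a x
    rw [mul_mem_subTraces_iff] at hxS
    exact ⟨y, ⟨hxS.1, hy, by simpa [hu] using hk⟩, u,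
      ⟨mem_subTraces_sdiff_singleton.2 ⟨hxS.2, hu⟩, (maxLabels_right_subset y u).trans hx⟩, rfl⟩
  · rintro ⟨y, ⟨hyS, hy, hk⟩, u, ⟨huS, hu⟩, rfl⟩
    rw [mem_subTraces_sdiff_singleton] at huS
    refine ⟨⟨mul_mem hyS huS.1, fun b hb => ?_⟩, by simp [hk, huS.2]⟩
    obtain hb | hb := maxLabels_mul_subset hr hs y u hb
    · rw [show b = a from hy hb]
      exact (Finset.mem_inter.1 ha).2
    · exact hu hb

theorem pyramids_mul_inj {S S' T : Finset σ} {a : σ} {k : ℕ} {y y' v v' : TraceMonoid R}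
    (hy : y ∈ pyramids R S a k) (hv : v ∈ tracesWithMax R (S' \ {a}) T)
    (hy' : y' ∈ pyramids R S a k) (hv' : v' ∈ tracesWithMax R (S' \ {a}) T)
    (h : y * v = y' * v') : y = y' ∧ v = v' :=
  eq_and_eq_of_mul_eq_mul hr hs hy.2.1 hy'.2.1 (mem_subTraces_sdiff_singleton.1 hv.1).2
    (mem_subTraces_sdiff_singleton.1 hv'.1).2 h

end Factorization

/-! ### Law of the output -/

section Law

/-- Injectivity of `g` on `P × Q` leaves a single nonzero term in the double sum. -/
theorem bind_bind_pure_apply {α β γ : Type*} {m : PMF α} {q : α → PMF β} {g : α → β → γ}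
    {P : Set α} {Q : Set β} (hm : ∀ y ∉ P, m y = 0) (hq : ∀ y, ∀ v ∉ Q, q y v = 0)
    (hg : ∀ y ∈ P, ∀ v ∈ Q, ∀ y' ∈ P, ∀ v' ∈ Q, g y v = g y' v' → y = y' ∧ v = v')
    {y : α} {v : β} (hy : y ∈ P) (hv : v ∈ Q) :
    (m.bind fun y => (q y).bind fun v => PMF.pure (g y v)) (g y v) = m y * q y v := by
  classical
  rw [PMF.bind_apply, tsum_eq_single y]
  · rw [PMF.bind_apply, tsum_eq_single v]
    · simp
    · intro v' hne
      by_cases hv' : v' ∈ Q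
      · rw [PMF.pure_apply, if_neg, mul_zero]
        exact fun h => hne (hg y hy v hv y hy v' hv' h).2.symm
      · rw [hq y v' hv', zero_mul]
  · intro y' hne
    by_cases hy' : y' ∈ P
    · rw [PMF.bind_apply, ENNReal.tsum_eq_zero.2, mul_zero]
      intro v'
      by_cases hv' : v' ∈ Q
      · rw [PMF.pure_apply, if_neg, mul_zero]
        exact fun h => hne (hg y hy v hv y' hy' v' hv' h).1.symm
      · rw [hq y' v' hv', zero_mul]
    · rw [hm y' hy', zero_mul]

variable {σ : Type u} {R : σ → σ → Prop}

/-- The probability of each trace `x` in `P` is `A * p ^ |x|`, and the other traces have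
probability zero. -/
def IsMultiplicativeOn (m : PMF (TraceMonoid R)) (P : Set (TraceMonoid R)) (p A : ℝ) : Prop :=
  (∀ x ∈ P, m x = ENNReal.ofReal (A * p ^ length x)) ∧ ∀ x ∉ P, m x = 0

theorem isMultiplicativeOn_pure_one (p : ℝ) :
    IsMultiplicativeOn (PMF.pure (1 : TraceMonoid R)) {1} p 1 := by
  constructor
  · rintro x rfl
    simp
  · intro x hx
    exact PMF.pure_apply_of_ne _ _ hx

/-- The law `q y` may vary with `y`, but its support set and constant may not: this is why the
choices can depend on the variables. The number `n` counts the letters added by `g`: one in a loop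
pass, none in the final product. -/
theorem IsMultiplicativeOn.bind {m : PMF (TraceMonoid R)} {q : TraceMonoid R → PMF (TraceMonoid R)}
    {g : TraceMonoid R → TraceMonoid R → TraceMonoid R} {P Q P' : Set (TraceMonoid R)}
    {p A B C : ℝ} {n : ℕ} (hm : IsMultiplicativeOn m P p A)
    (hq : ∀ y, IsMultiplicativeOn (q y) Q p B) (hp : 0 < p) (hA : 0 ≤ A) (hC : C * p ^ n = A * B)
    (hlen : ∀ y v, length (g y v) = length y + length v + n)
    (hg : ∀ y ∈ P, ∀ v ∈ Q, ∀ y' ∈ P, ∀ v' ∈ Q, g y v = g y' v' → y = y' ∧ v = v')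
    (hP' : ∀ x, x ∈ P' ↔ ∃ y ∈ P, ∃ v ∈ Q, x = g y v) :
    IsMultiplicativeOn (m.bind fun y => (q y).bind fun v => PMF.pure (g y v)) P' p C := by
  constructor
  · intro x hx
    obtain ⟨y, hy, v, hv, rfl⟩ := (hP' x).1 hx
    rw [bind_bind_pure_apply hm.2 (fun y => (hq y).2) hg hy hv, hm.1 y hy, (hq y).1 v hv,
      ← ENNReal.ofReal_mul (by positivity), hlen]
    congr 1
    rw [pow_add, pow_add]
    linear_combination (-p ^ length y * p ^ length v) * hC
  · intro x hx
    rw [PMF.apply_eq_zero_iff]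
    intro h
    obtain ⟨y, hy, h⟩ := (PMF.mem_support_bind_iff _ _ _).1 h
    obtain ⟨v, hv, h⟩ := (PMF.mem_support_bind_iff _ _ _).1 h
    rw [PMF.mem_support_pure_iff] at h
    refine hx ((hP' x).2 ⟨y, ?_, v, ?_, h⟩)
    · by_contra hy'
      exact hy (hm.2 y hy')
    · by_contra hv'
      exact hv ((hq y).2 v hv')

theorem geometric_apply {r : ℝ} (h0 : 0 ≤ r) (h1 : r < 1) (k : ℕ) :
    geometric r k = ENNReal.ofReal ((1 - r) * r ^ k) :=
  DFunLike.congr_fun (dif_pos (⟨h0, h1⟩ : 0 ≤ r ∧ r < 1)) k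

variable [Fintype σ] [DecidableEq σ] [DecidableRel R]

theorem isMultiplicativeOn_run (hr : ∀ a, R a a) (hs : ∀ a b, R a b → R b a) {p : ℝ} (hp : 0 < p)
    (hpos : ∀ S : Finset σ, 0 < (mobius R S).eval p) (c : OpCosts) (draw : ℕ → ℕ)
    {S T : Finset σ} (d : Choices R S T) :
    IsMultiplicativeOn ((run c draw p d).map Prod.fst) (tracesWithMax R S T) p
      ((mobius R S).eval p / (mobius R (S \ T)).eval p) := by
  induction d with
  | @halt S T h =>
    rw [run, Timed.fst_tick, Timed.fst_ret, tracesWithMax_of_inter_eq_empty h,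
      Finset.sdiff_eq_self_of_disjoint (Finset.disjoint_iff_inter_eq_empty.2 h),
      div_self (hpos S).ne']
    exact isMultiplicativeOn_pure_one p
  | @step S T a ha V U ihV ihU =>
    have haS := (Finset.mem_inter.1 ha).1
    have haT := (Finset.mem_inter.1 ha).2
    have hsdiff {T' : Finset σ} (h : a ∈ T') : (S \ {a}) \ T' = S \ T' := by
      ext b
      simp only [Finset.mem_sdiff, Finset.mem_singleton]
      exact ⟨fun hb => ⟨hb.1.1, hb.2⟩, fun hb => ⟨⟨hb.1, fun hba => hb.2 (hba ▸ h)⟩, hb.2⟩⟩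
    rw [hsdiff (by simp [link, hr])] at ihV
    rw [hsdiff haT] at ihU
    obtain ⟨hr0, hr1⟩ := geomParam_mem hr hs hp hpos haS
    have hrV := geomParam_eq hr hs hpos haS
    have hrU : (1 - geomParam R S p a) = (mobius R S).eval p / (mobius R (S \ {a})).eval p := by
      rw [geomParam]; ring
    have hpV := hpos (S \ link R a)
    have hpa := hpos (S \ {a})
    set r := geomParam R S p a with hrdef
    -- `K` only selects the choices, while `n` counts the passes done. A pass multiplies the
    -- constant by `p / r`, and its extra letter `a` absorbs the `p`.
    have hloop (K n : ℕ) : IsMultiplicativeOn ((Timed.forLoop (fun i ξ =>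
        Timed.bind (run c draw p (V K i ξ)) fun v =>
          Timed.tick (c.assign + 2 * c.mul + c.assign + c.loop)
            (Timed.ret (ξ * v * letter R a))) 1 n).map Prod.fst)
        (pyramids R S a n) p (r⁻¹ ^ n) := by
      induction n with
      | zero =>
        rw [Timed.forLoop, Timed.fst_ret, pyramids_zero, pow_zero]
        exact isMultiplicativeOn_pure_one p
      | succ n ih =>
        rw [Timed.forLoop, Timed.fst_bind]
        simp only [Timed.fst_bind, Timed.fst_tick, Timed.fst_ret]
        refine ih.bind (n := 1) (ihV K n) hp (by positivity) ?_ (fun y v => by simp)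
          (fun y hy v hv y' hy' v' hv' h => ?_) fun x => mem_pyramids_succ_iff hr hs haS
        · rw [pow_succ, pow_one, mul_assoc]
          congr 1
          rw [hrV]
          field_simp
        · exact pyramids_mul_inj hr hs hy hv hy' hv' (mul_letter_right_cancel hr hs h)
    have hbody (K : ℕ) := (hloop K K).bind (n := 0) (g := fun ξ u => ξ * u) (ihU K) hp
      (by positivity) (by rw [pow_zero, mul_one]) (fun y v => by simp)
      (fun y hy v hv y' hy' v' hv' h => pyramids_mul_inj hr hs hy hv hy' hv' h)
      fun x => mem_tracesWithMax_and_count_iff hr hs ha (k := K)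
    have hrun : (run c draw p (.step a ha V U)).map Prod.fst = (geometric r).bind fun K =>
        ((Timed.forLoop (fun i ξ => Timed.bind (run c draw p (V K i ξ)) fun v =>
          Timed.tick (c.assign + 2 * c.mul + c.assign + c.loop)
            (Timed.ret (ξ * v * letter R a))) 1 K).map Prod.fst).bind fun ξ =>
              ((run c draw p (U K ξ)).map Prod.fst).bind fun u => PMF.pure (ξ * u) := by
      rw [run]
      simp only [Timed.fst_bind, Timed.fst_tick, Timed.fst_ret, PMF.map_comp]
      congr 1
      exact PMF.map_id _
    rw [hrun]
    constructor
    · intro x hx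
      -- Only the draw `K` equal to the number of `a` in `x` can produce `x`; its weight `(1 - r) *
      -- r ^ K` cancels `r⁻¹ ^ K`.
      rw [PMF.bind_apply, tsum_eq_single (count a x)]
      · rw [(hbody _).1 x ⟨hx, rfl⟩, geometric_apply hr0.le hr1,
          ← ENNReal.ofReal_mul (by have := sub_pos.2 hr1; positivity), hrU, inv_pow]
        congr 1
        have := hpos (S \ T)
        field_simp
      · intro K hK
        rw [(hbody K).2 x fun h => hK h.2.symm, mul_zero]
    · intro x hx
      rw [PMF.bind_apply, ENNReal.tsum_eq_zero]
      intro K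
      rw [(hbody K).2 x fun h => hx h.1, mul_zero]

instance : DiscreteMeasurableSpace (TraceMonoid R) := ⟨fun _ => trivial⟩

theorem multProb_singleton (S : Finset σ) (p : ℝ) (x : TraceMonoid R)
    [Decidable (x ∈ subTraces R S)] :
    multProb R S p {x} =
      if x ∈ subTraces R S then ENNReal.ofReal ((mobius R S).eval p * p ^ length x) else 0 := by
  classical
  rw [multProb, Measure.sum_apply _ (MeasurableSet.singleton x)]
  simp only [Measure.smul_apply, smul_eq_mul, Measure.dirac_apply, Set.indicator_apply,
    Set.mem_singleton_iff, Pi.one_apply, mul_ite, mul_one, mul_zero]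
  split_ifs with h
  · rw [tsum_eq_single (⟨x, h⟩ : subTraces R S)]
    · simp
    · intro y hy
      rw [if_neg fun h' => hy (Subtype.ext h')]
  · rw [ENNReal.tsum_eq_zero]
    intro y
    rw [if_neg]
    rintro rfl
    exact h y.2

variable (hr : ∀ a, R a a) (hs : ∀ a b, R a b → R b a) {p : ℝ} (hp : 0 < p)
  (hpos : ∀ S : Finset σ, 0 < (mobius R S).eval p) (c : OpCosts) (draw : ℕ → ℕ)
include hr hs hp hpos

theorem restrict_multProb {S T : Finset σ} (d : Choices R S T) :
    (multProb R S p).restrict {ξ | maxLabels ξ ⊆ (T : Set σ)} =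
      ENNReal.ofReal ((mobius R (S \ T)).eval p) • outputLaw c draw p d := by
  classical
  refine Measure.ext_of_singleton fun x => ?_
  obtain ⟨h1, h2⟩ := isMultiplicativeOn_run hr hs hp hpos c draw d
  rw [Measure.restrict_apply (MeasurableSet.singleton x), Measure.smul_apply, outputLaw,
    PMF.toMeasure_apply_singleton _ _ (MeasurableSet.singleton x), smul_eq_mul]
  have := hpos (S \ T)
  by_cases hx : maxLabels x ⊆ T
  · rw [Set.inter_eq_left.2 (Set.singleton_subset_iff.2 hx), multProb_singleton]
    split_ifs with hS
    · rw [h1 x ⟨hS, hx⟩, ← ENNReal.ofReal_mul this.le]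
      congr 1
      field_simp
    · rw [h2 x fun h => hS h.1, mul_zero]
  · rw [h2 x fun h => hx h.2, mul_zero]
    convert measure_empty (μ := multProb R S p)
    ext y
    simp only [Set.mem_inter_iff, Set.mem_singleton_iff, Set.mem_empty_iff_false, iff_false]
    rintro ⟨rfl, h⟩
    exact hx h

theorem outputLaw_eq_cond {S T : Finset σ} (d : Choices R S T) :
    outputLaw c draw p d =
      ProbabilityTheory.cond (multProb R S p) {ξ | maxLabels ξ ⊆ (T : Set σ)} := by
  have h := restrict_multProb hr hs hp hpos c draw d
  -- The output law has total mass `1`, which gives the mass of the conditioning event.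
  have h1 : multProb R S p {ξ | maxLabels ξ ⊆ (T : Set σ)} =
      ENNReal.ofReal ((mobius R (S \ T)).eval p) := by
    have : IsProbabilityMeasure (outputLaw c draw p d) := by
      rw [outputLaw]; infer_instance
    have h' := congrArg (· Set.univ) h
    simpa using h'
  rw [ProbabilityTheory.cond, h1, h, smul_smul,
    ENNReal.inv_mul_cancel (by simpa using hpos (S \ T)) ENNReal.ofReal_ne_top, one_smul]

/-- With `T = Σ` the condition is void and the factor is `μ_∅(p) = 1`. -/
theorem multProb_eq_outputLaw {S : Finset σ} (d : Choices R S Finset.univ) :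
    multProb R S p = outputLaw c draw p d := by
  have h := restrict_multProb hr hs hp hpos c draw d
  rw [Finset.sdiff_eq_empty_iff_subset.2 (Finset.subset_univ S)] at h
  simpa using h

end Law

end TraceSampling

end

theorem theorem1 (c : TraceSampling.OpCosts) :
    ∃ C : ℕ, ∀ (σ : Type u) [Fintype σ] [DecidableEq σ] (R : σ → σ → Prop) [DecidableRel R],
      (∀ a, R a a) → (∀ a b, R a b → R b a) →
      ∀ p : ℝ, 0 < p → ENNReal.ofReal p < TraceSampling.smallestRoot R Finset.univ →
      ∀ draw : ℕ → ℕ, (∀ k, draw k ≤ k) →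
        -- every `B_{S,p}` is a probability, and every execution is well defined:
        -- no division by zero, and geometric laws with a parameter in `(0, 1)`
        (∀ S : Finset σ, 0 < (TraceSampling.mobius R S).eval p ∧
          MeasureTheory.IsProbabilityMeasure (TraceSampling.multProb R S p)) ∧
        (∀ S : Finset σ, ∀ a ∈ S, 0 < TraceSampling.geomParam R S p a ∧
          TraceSampling.geomParam R S p a < 1) ∧
        (∀ S T : Finset σ, Nonempty (TraceSampling.Choices R S T)) ∧
        -- law of the output on input `(Σ, Σ)`, and on input `(S, T)`
        (∀ d : TraceSampling.Choices R Finset.univ Finset.univ,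
          TraceSampling.outputLaw c draw p d = TraceSampling.multProb R Finset.univ p) ∧
        (∀ (S T : Finset σ) (d : TraceSampling.Choices R S T),
          TraceSampling.outputLaw c draw p d =
            ProbabilityTheory.cond (TraceSampling.multProb R S p)
              {ξ | TraceSampling.maxLabels ξ ⊆ (T : Set σ)}) ∧
        -- number of steps on input `(Σ, Σ)`, and on input `(S, T)`
        (Nonempty σ → ∀ d : TraceSampling.Choices R Finset.univ Finset.univ,
          ∀ e ∈ (TraceSampling.run c draw p d).support,
            e.2 ≤ C * (Fintype.card σ * (TraceSampling.length e.1 + 1))) ∧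
        (∀ (S T : Finset σ) (d : TraceSampling.Choices R S T),
          ∀ e ∈ (TraceSampling.run c draw p d).support,
            e.2 ≤ C * ((S.card + 1) * (TraceSampling.length e.1 + 1))) := by
  -- The factor `2` absorbs `|Σ| + 1 ≤ 2 * |Σ|` for a nonempty alphabet.
  refine ⟨2 * c.total, fun σ _ _ R _ hr hs p hp hroot draw hdraw => ?_⟩
  have hpos := TraceSampling.mobius_eval_pos hr hs hp hroot
  refine ⟨fun S => ⟨hpos S, ?_⟩, fun S a ha => TraceSampling.geomParam_mem hr hs hp hpos ha,
    TraceSampling.nonempty_choices R,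
    fun d => (TraceSampling.multProb_eq_outputLaw hr hs hp hpos c draw d).symm,
    fun S T d => TraceSampling.outputLaw_eq_cond hr hs hp hpos c draw d,
    fun _ d e he => ?_, fun S T d e he => ?_⟩
  · obtain ⟨d⟩ := TraceSampling.nonempty_choices R S Finset.univ
    rw [TraceSampling.multProb_eq_outputLaw hr hs hp hpos c draw d, TraceSampling.outputLaw]
    infer_instance
  · have hcard : Fintype.card σ + 1 ≤ 2 * Fintype.card σ := by
      have : 0 < Fintype.card σ := Fintype.card_pos
      omega
    calc e.2 ≤ c.total * ((Fintype.card σ + 1) * (TraceSampling.length e.1 + 1)) :=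
          TraceSampling.steps_run_le c hdraw p d e he
      _ ≤ c.total * (2 * Fintype.card σ * (TraceSampling.length e.1 + 1)) := by gcongr
      _ = _ := by ring
  · refine (TraceSampling.steps_run_le c hdraw p d e he).trans ?_
    gcongr
    omega
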